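/- **Setting.** For each sample size $n$ let $Y_i = f(x_i)+\varepsilon_i$, $i=1,\dots,n$, with fixed design points $x_i\in\mathbb R^p$ and independent errors $\varepsilon_i\sim N(0,\sigma^2)$, where $\sigma^2>0$ is known; the regression function $f$, the dimension $p$ and the design may change with $n$. Write $\mathbf Y_n=(Y_1,\dots,Y_n)^T$ and $f_n=(f(x_1),\dots,f(x_n))^T$, and let $\|\cdot\|$ be the Euclidean norm. Let $\Gamma=\Gamma_n$ index a list of candidate models; model $k$ is a finite-dimensional linear family $\mathcal F_k=\{\sum_i\theta_i\phi_{k,i}:\theta\in\mathbb R^{m_k}\}$ of regression functions. Let $M_k$ be the orthogonal projection of $\mathbb R^n$ onto the column space of the design matrix of model $k$, and $r_k$ its rank. Let $S_1(k)$ be the set of sub-models $k'\in\Gamma$ of $k$ (that is, $\mathcal F_{k'}\subseteq\mathcal F_k$) with $r_{k'}=r_k-1$; it is assumed that $S_1(k)\neq\emptyset$ whenever $r_k>1$. Let $N_j$ be the number of $k\in\Gamma$ with $r_k=j$, and $L_j=\max\{\operatorname{card}S_1(k):k\in\Gamma,\ r_k=j\}$. Let $\lambda_n\ge(\log n)^{-1}$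 for $n\ge 2$, let $d\ge0$, and put $$IC(k)=\|\mathbf Y_n-M_k\mathbf Y_n\|^2+\lambda_n\log(n)\,r_k\sigma^2-n\sigma^2+d\,n^{1/2}\log(n)\,\sigma^2,$$ $$Q_n(k)=(\lambda_n\log(n)-1)\,r_k+\|(I_n-M_k)f_n\|^2/\sigma^2+d\,n^{1/2}\log(n),\qquad B_{j,n}=\inf\{Q_n(k):k\in\Gamma,\ r_k=j\}.$$ Let $\hat k_n\in\Gamma$ be the (random) selected model, and define the parametricness index $\mathrm{PI}_n=\inf_{k\in S_1(\hat k_n)}IC(k)/IC(\hat k_n)$ if $r_{\hat k_n}>1$, and $\mathrm{PI}_n=n$ otherwise. **Theorem.** Consider the nonparametric scenario: for each $n$, the true regression function belongs to none of the families $\mathcal F_k$, $k\in\Gamma$. Suppose that there are integers $a_n,b_n$ with $a_n\to\infty$ and, for all large $n$, $1\le a_n<b_n<n$, such that, with $J_n$ the set of those $j\in[a_n,b_n]$ that are the rank of at least one candidate model, - (N1) $P(a_n\le r_{\hat k_n}\le b_n)\to1$ and $\sup_{j\in J_n}\dfrac{B_{j,n}}{n-j}\to0$; - (N2) there are a positive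 sequence $\zeta_n\to0$ and a constant $c_0>0$ such that, for all large $n$ and all $j\in J_n$, $N_jL_j\le c_0e^{\zeta_nB_{j,n}}$ and $N_j\le c_0e^{B_{j,n}^2/(10(n-j))}$; moreover $\displaystyle\lim_{n\to\infty}\sum_{j\in J_n}e^{-B_{j,n}^2/(10(n-j))}=0$; - (N3) $\displaystyle\limsup_{n\to\infty}\ \sup_{k\in\Gamma:\,a_n\le r_k\le b_n}\ \frac{\inf_{k'\in S_1(k)}\|(M_k-M_{k'})f_n\|^2}{Q_n(k)}=0$. Then $\mathrm{PI}_n\to1$ in probability as $n\to\infty$. -/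

import Mathlib

open Filter Topology MeasureTheory ProbabilityTheory
open scoped ENNReal

noncomputable section

namespace ParametricnessIndex

/-- A family of regression functions on `ℝ^p` that is linear in a parameter of dimension `m`,
given by its `m` terms. -/
structure LinearModel (p : ℕ) where
  m : ℕ
  term : Fin m → (Fin p → ℝ) → ℝ

/-- The regression function with parameter `θ`. -/
def LinearModel.eval {p : ℕ} (k : LinearModel p) (θ : Fin k.m → ℝ) : (Fin p → ℝ) → ℝ :=
  fun x => ∑ i, θ i * k.term i x

/-- The family of all regression functions of the model. -/
def LinearModel.family {p : ℕ} (k : LinearModel p) : Set ((Fin p → ℝ) → ℝ) :=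
  Set.range k.eval

/-- The fixed data at sample size `n`: the design points, the true regression function, and the
list of candidate models, which may be infinite. -/
structure Setup (n : ℕ) where
  p : ℕ
  x : Fin n → Fin p → ℝ
  f : (Fin p → ℝ) → ℝ
  Index : Type
  model : Index → LinearModel p

namespace Setup

variable {n : ℕ} (R : Setup n)

/-- The vector `f_n` of values of the true regression function at the design points. -/
def fvec : EuclideanSpace ℝ (Fin n) := WithLp.toLp 2 fun i => R.f (R.x i)

/-- The response vector `Y = f_n + e`. -/
def response (e : Fin n → ℝ) : EuclideanSpace ℝ (Fin n) :=
  WithLp.toLp 2 fun i => R.f (R.x i) + e i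

/-- The column space of the design matrix of model `k`. -/
def colSpace (k : R.Index) : Submodule ℝ (EuclideanSpace ℝ (Fin n)) :=
  Submodule.span ℝ
    (Set.range fun i : Fin (R.model k).m =>
      (WithLp.toLp 2 fun l : Fin n => (R.model k).term i (R.x l) : EuclideanSpace ℝ (Fin n)))

/-- The projection `M_k` onto the column space of model `k`. -/
def proj (k : R.Index) : EuclideanSpace ℝ (Fin n) →L[ℝ] EuclideanSpace ℝ (Fin n) :=
  (R.colSpace k).starProjection

/-- The rank `r_k` of `M_k`, that is, the dimension of its range. -/
def rank (k : R.Index) : ℕ := Module.finrank ℝ (R.colSpace k)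

/-- `S₁(k)`: the candidate models that are sub-models of `k` and have rank `r_k - 1`. -/
def S₁ (k : R.Index) : Set R.Index :=
  {k' | (R.model k').family ⊆ (R.model k).family ∧ R.rank k' + 1 = R.rank k}

/-- `N_j`: the number of candidate models of rank `j`. -/
def N (j : ℕ) : ℕ∞ := {k : R.Index | R.rank k = j}.encard

/-- `L_j`: the largest cardinality of `S₁(k)` over the candidate models `k` of rank `j`. -/
def L (j : ℕ) : ℕ∞ := ⨆ k ∈ {k : R.Index | R.rank k = j}, (R.S₁ k).encard

/-- The ranks in `[a, b]` that some candidate model has. -/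
def ranks (a b : ℕ) : Finset ℕ :=
  open Classical in (Finset.Icc a b).filter fun j => ∃ k, R.rank k = j

/-- `(λ log n - 1) r_k + ‖(I - M_k) f_n‖² / σ² + d √n log n`. -/
def Q (lam d σ : ℝ) (k : R.Index) : ℝ :=
  (lam * Real.log n - 1) * R.rank k + ‖R.fvec - R.proj k R.fvec‖ ^ 2 / σ ^ 2
    + d * Real.sqrt n * Real.log n

/-- `B_{j,n}`: the infimum of the preceding quantity over the candidate models of rank `j`.
It is used only for ranks `j` that some candidate model has. -/
def B (lam d σ : ℝ) (j : ℕ) : ℝ := sInf (R.Q lam d σ '' {k | R.rank k = j})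

/-- The information criterion of model `k` for known `σ`, at the error vector `e`. -/
def IC (lam d σ : ℝ) (e : Fin n → ℝ) (k : R.Index) : ℝ :=
  ‖R.response e - R.proj k (R.response e)‖ ^ 2 + lam * Real.log n * R.rank k * σ ^ 2
    - n * σ ^ 2 + d * Real.sqrt n * Real.log n * σ ^ 2

open Classical in
/-- The parametricness index when the selected model is `k`, at the error vector `e`. -/
def PI (lam d σ : ℝ) (e : Fin n → ℝ) (k : R.Index) : ℝ :=
  if 1 < R.rank k then
    sInf ((fun k' => R.IC lam d σ e k' / R.IC lam d σ e k) '' R.S₁ k)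
  else n

end Setup

section Conditions

variable (R : (n : ℕ) → Setup n) (lam : ℕ → ℝ) (d σ : ℝ) (a b : ℕ → ℕ)

/-- The selected rank lies in `[a_n, b_n]` with probability tending to one, and
`sup_j B_{j,n} / (n - j) → 0`. -/
def N1 {Ω : Type*} [MeasurableSpace Ω] (P : Measure Ω) (khat : (n : ℕ) → Ω → (R n).Index) :
    Prop :=
  Tendsto (fun n => P {ω | a n ≤ (R n).rank (khat n ω) ∧ (R n).rank (khat n ω) ≤ b n})
      atTop (𝓝 1) ∧
    Tendsto (fun n => ⨆ j ∈ (R n).ranks (a n) (b n),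
      ENNReal.ofReal ((R n).B (lam n) d σ j / ((n : ℝ) - j))) atTop (𝓝 0)

/-- The numbers of models are controlled by the quantities `B_{j,n}`. -/
def N2 : Prop :=
  (∃ (ζ : ℕ → ℝ) (c₀ : ℝ), (∀ n, 0 < ζ n) ∧ Tendsto ζ atTop (𝓝 0) ∧ 0 < c₀ ∧
    ∀ᶠ n in atTop, ∀ j ∈ (R n).ranks (a n) (b n),
      (((R n).N j * (R n).L j : ℕ∞) : ℝ≥0∞) ≤
          ENNReal.ofReal (c₀ * Real.exp (ζ n * (R n).B (lam n) d σ j)) ∧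
        (((R n).N j : ℕ∞) : ℝ≥0∞) ≤
          ENNReal.ofReal
            (c₀ * Real.exp ((R n).B (lam n) d σ j ^ 2 / (10 * ((n : ℝ) - j))))) ∧
    Tendsto (fun n => ∑ j ∈ (R n).ranks (a n) (b n),
      Real.exp (-((R n).B (lam n) d σ j ^ 2 / (10 * ((n : ℝ) - j))))) atTop (𝓝 0)

/-- The least significant term of the projection of `f_n` is negligible. -/
def N3 : Prop :=
  limsup (fun n => ⨆ k ∈ {k : (R n).Index | a n ≤ (R n).rank k ∧ (R n).rank k ≤ b n},
    (⨅ k' ∈ (R n).S₁ k,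
        ENNReal.ofReal (‖(R n).proj k (R n).fvec - (R n).proj k' (R n).fvec‖ ^ 2)) /
      ENNReal.ofReal ((R n).Q (lam n) d σ k)) atTop = 0

end Conditions

end ParametricnessIndex

end

/-! With `z` the standardized noise, `IC k / σ²` is its mean `Q k` plus a centred chi-squared term
in `(I - M_k) z` and a Gaussian term linear in `(I - M_k) f_n`. For `k' ∈ S₁ k`, Pythagoras gives
`IC k' - IC k = ‖(M_k - M_k') Y‖² - λ log(n) σ²`. If the fluctuations leave `IC k ≥ σ² Q k / 20`, it
is enough that the penalty is small against `Q k`, which bounds all ratios from below, and that the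
squared norm is small for one `k'`, which bounds the infimum from above (`abs_PI_sub_one_le`). The
penalty is small because ranks and `Q` grow, the signal part of the norm by (N3), and the noise part
because `M_k - M_k'` has rank one, so that it is the square of a single Gaussian variable.

Nothing is known about how the model is selected, so the noise must behave for all models with rank
in the window at once. `stdGaussian_biUnion_deviationSet_le` is the union bound at one rank `j`:
each tail beats the model count in (N2) and leaves a multiple of `exp(-B_j² / (10 (n - j)))`, whose
sum over `j` tends to zero. -/

namespace ProbabilityTheory

open scoped RealInnerProductSpace

/-! ### Tail bounds for standard Gaussian vectors. -/

lemma integral_exp_neg_mul_sq_gaussianReal {s : ℝ} (hs : 0 ≤ s) :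
    ∫ x, Real.exp (-s * x ^ 2) ∂(gaussianReal 0 1) = (√(1 + 2 * s))⁻¹ := by
  rw [integral_gaussianReal_eq_integral_smul (by simp)]
  have h : ∀ x : ℝ, gaussianPDFReal 0 1 x • Real.exp (-s * x ^ 2)
      = (√(2 * Real.pi))⁻¹ * Real.exp (-(1 / 2 + s) * x ^ 2) := by
    intro x
    simp only [gaussianPDFReal, NNReal.coe_one, mul_one, sub_zero, smul_eq_mul]
    rw [mul_assoc, ← Real.exp_add]
    ring_nf
  simp_rw [h]
  rw [integral_const_mul, integral_gaussian, ← Real.sqrt_inv, ← Real.sqrt_inv,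
    ← Real.sqrt_mul (by positivity)]
  congr 1
  field_simp

/-- Follows from `log (1 + x) ≥ 2x / (x + 2)` at `x = 2s`; it turns the chi-squared Laplace
transform into a sub-Gaussian bound for the lower tail. -/
lemma inv_sqrt_one_add_two_mul_le {s : ℝ} (hs : 0 ≤ s) :
    (√(1 + 2 * s))⁻¹ ≤ Real.exp (s ^ 2 - s) := by
  have h1 := Real.le_log_one_add_of_nonneg (x := 2 * s) (by positivity)
  have h2 : 2 * s - 2 * s ^ 2 ≤ 2 * (2 * s) / (2 * s + 2) := by
    rw [le_div_iff₀ (by positivity)]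
    nlinarith [pow_nonneg hs 3]
  rw [inv_le_comm₀ (by positivity) (Real.exp_pos _), ← Real.exp_neg]
  refine Real.le_sqrt_of_sq_le ?_
  rw [← Real.exp_nat_mul, ← Real.le_log_iff_exp_le (by positivity)]
  push_cast
  linarith

section

variable {E : Type*} [NormedAddCommGroup E] [InnerProductSpace ℝ E] [FiniteDimensional ℝ E]
  [MeasurableSpace E] [BorelSpace E]

lemma integral_exp_neg_mul_norm_sq_stdGaussian_le {s : ℝ} (hs : 0 ≤ s) :
    ∫ x, Real.exp (-s * ‖x‖ ^ 2) ∂(stdGaussian E)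
      ≤ Real.exp (Module.finrank ℝ E * (s ^ 2 - s)) := by
  have hm : Measurable fun x : Fin (Module.finrank ℝ E) → ℝ =>
      ∑ i, x i • stdOrthonormalBasis ℝ E i := by fun_prop
  rw [stdGaussian, integral_map hm.aemeasurable
    (Measurable.aestronglyMeasurable (by fun_prop))]
  have h : ∀ x : Fin (Module.finrank ℝ E) → ℝ,
      Real.exp (-s * ‖∑ i, x i • stdOrthonormalBasis ℝ E i‖ ^ 2)
        = ∏ i, Real.exp (-s * x i ^ 2) := by
    intro x
    rw [← Real.exp_sum, ← Finset.mul_sum, ← real_inner_self_eq_norm_sq,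
      (stdOrthonormalBasis ℝ E).orthonormal.inner_sum]
    simp [sq]
  simp_rw [h]
  rw [integral_fintype_prod_eq_prod (f := fun _ (x : ℝ) => Real.exp (-s * x ^ 2)),
    Finset.prod_congr rfl fun _ _ => integral_exp_neg_mul_sq_gaussianReal hs]
  simp only [Finset.prod_const, Finset.card_univ, Fintype.card_fin]
  rw [Real.exp_nat_mul]
  gcongr
  exact inv_sqrt_one_add_two_mul_le hs

/-- Characteristic functions agree, since pairing a projected vector with `t ∈ W` is pairing the
vector itself with `t`. -/
lemma stdGaussian_map_orthogonalProjection (W : Submodule ℝ E) :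
    (stdGaussian E).map W.orthogonalProjectionOnto = stdGaussian W := by
  have : IsProbabilityMeasure ((stdGaussian E).map W.orthogonalProjectionOnto) :=
    Measure.isProbabilityMeasure_map (by fun_prop)
  apply Measure.ext_of_charFun
  ext t
  rw [charFun_apply, integral_map (by fun_prop) (Measurable.aestronglyMeasurable (by fun_prop)),
    charFun_stdGaussian]
  have h : ∀ x : E, ⟪W.orthogonalProjectionOnto x, t⟫ = ⟪x, (t : E)⟫ := fun x =>
    Submodule.inner_orthogonalProjectionOnto_eq_of_mem_right t x
  simp_rw [h]
  rw [← charFun_apply, charFun_stdGaussian]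
  rfl

/-- The lower tail of a chi-squared variable, as the squared norm of a projection of a standard
Gaussian vector. -/
lemma stdGaussian_norm_sq_starProjection_le (W : Submodule ℝ E) {m : ℝ} (hm : 0 < m)
    (hW : (Module.finrank ℝ W : ℝ) = m) {x : ℝ} (hx : 0 ≤ x) :
    stdGaussian E {y | ‖W.starProjection y‖ ^ 2 ≤ m - x}
      ≤ ENNReal.ofReal (Real.exp (-(x ^ 2 / (4 * m)))) := by
  have h0 : {y | ‖W.starProjection y‖ ^ 2 ≤ m - x}
      = W.orthogonalProjectionOnto ⁻¹' {z : W | ‖z‖ ^ 2 ≤ m - x} := by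
    ext y; rfl
  rw [h0, ← Measure.map_apply (by fun_prop) (measurableSet_le (by fun_prop) (by fun_prop)),
    stdGaussian_map_orthogonalProjection]
  -- `s = x / (2m)` minimizes the Chernoff exponent `s (m - x) + m (s² - s) = m s² - s x`.
  have hs : 0 ≤ x / (2 * m) := by positivity
  have hint : Integrable (fun z : W => Real.exp (-(x / (2 * m)) * ‖z‖ ^ 2)) (stdGaussian W) := by
    refine Integrable.of_bound (Measurable.aestronglyMeasurable (by fun_prop)) 1 (ae_of_all _ ?_)
    intro z
    rw [Real.norm_eq_abs, Real.abs_exp, Real.exp_le_one_iff]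
    nlinarith [sq_nonneg ‖z‖]
  have h := measure_le_le_exp_mul_mgf (μ := stdGaussian W) (X := fun z : W => ‖z‖ ^ 2)
    (t := -(x / (2 * m))) (m - x) (by linarith) hint
  rw [← ofReal_measureReal]
  refine ENNReal.ofReal_le_ofReal (h.trans ?_)
  have h2 := integral_exp_neg_mul_norm_sq_stdGaussian_le (E := W) hs
  rw [hW] at h2
  refine (mul_le_mul_of_nonneg_left h2 (Real.exp_pos _).le).trans ?_
  rw [← Real.exp_add, Real.exp_le_exp]
  apply le_of_eq
  field_simp
  ring

/-- Chernoff bound with `s` left free, so that it can be chosen from an upper bound on `‖v‖` alone,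
even when `v = 0`. -/
lemma stdGaussian_inner_ge_le (v : E) {s : ℝ} (hs : 0 ≤ s) (t : ℝ) :
    stdGaussian E {y | t ≤ ⟪v, y⟫}
      ≤ ENNReal.ofReal (Real.exp (s ^ 2 * ‖v‖ ^ 2 / 2 - s * t)) := by
  have hlaw : (stdGaussian E).map (fun y => ⟪v, y⟫) = gaussianReal 0 (‖v‖ ^ 2).toNNReal := by
    have := IsGaussian.map_eq_gaussianReal (μ := stdGaussian E) (innerSL ℝ v)
    rw [integral_strongDual_stdGaussian, variance_dual_stdGaussian, innerSL_apply_norm] at this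
    exact this
  have hmgf := mgf_gaussianReal hlaw s
  have hint : Integrable (fun y => Real.exp (s * ⟪v, y⟫)) (stdGaussian E) := by
    rw [← mgf_pos_iff, hmgf]
    exact Real.exp_pos _
  have h := measure_ge_le_exp_mul_mgf (μ := stdGaussian E) (X := fun y => ⟪v, y⟫) t hs hint
  rw [← ofReal_measureReal]
  refine ENNReal.ofReal_le_ofReal (h.trans ?_)
  rw [hmgf, ← Real.exp_add, Real.exp_le_exp, Real.coe_toNNReal _ (by positivity)]
  linarith

lemma stdGaussian_inner_sq_ge_le {v : E} (hv : ‖v‖ = 1) {c : ℝ} (hc : 0 ≤ c) :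
    stdGaussian E {y | c ≤ ⟪v, y⟫ ^ 2}
      ≤ ENNReal.ofReal (2 * Real.exp (-(c / 2))) := by
  have hsub : {y : E | c ≤ ⟪v, y⟫ ^ 2} ⊆ {y | √c ≤ ⟪v, y⟫} ∪ {y | √c ≤ ⟪-v, y⟫} := by
    intro y hy
    have := Real.sqrt_le_sqrt (show c ≤ ⟪v, y⟫ ^ 2 from hy)
    rw [Real.sqrt_sq_eq_abs, le_abs] at this
    simpa [inner_neg_left] using this
  have key : ∀ w : E, ‖w‖ = 1 → stdGaussian E {y | √c ≤ ⟪w, y⟫}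
      ≤ ENNReal.ofReal (Real.exp (-(c / 2))) := by
    intro w hw
    refine (stdGaussian_inner_ge_le w (Real.sqrt_nonneg c) (√c)).trans_eq ?_
    rw [hw, Real.sq_sqrt hc, Real.mul_self_sqrt hc]
    congr 2
    ring
  refine (measure_mono hsub).trans ((measure_union_le _ _).trans ?_)
  rw [two_mul, ENNReal.ofReal_add (Real.exp_pos _).le (Real.exp_pos _).le]
  exact add_le_add (key v hv) (key (-v) (by rwa [norm_neg]))

end

lemma hasLaw_stdGaussian_of_iIndepFun {Ω : Type*} [MeasurableSpace Ω] {P : Measure Ω}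
    [IsProbabilityMeasure P] {ι : Type*} [Fintype ι] {σ : ℝ} (hσ : 0 < σ) {e : ι → Ω → ℝ}
    (hindep : iIndepFun e P) (hlaw : ∀ i, HasLaw (e i) (gaussianReal 0 (σ ^ 2).toNNReal) P) :
    HasLaw (fun ω => (WithLp.toLp 2 fun i => σ⁻¹ * e i ω : EuclideanSpace ℝ ι))
      (stdGaussian (EuclideanSpace ℝ ι)) P := by
  have h1 : ∀ i, HasLaw (fun ω => σ⁻¹ * e i ω) (gaussianReal 0 1) P := by
    intro i
    have := gaussianReal_const_mul (hlaw i) σ⁻¹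
    convert this using 1
    congr 1
    · simp
    · ext
      simp only [NNReal.coe_one, NNReal.coe_mul, NNReal.coe_mk]
      rw [Real.coe_toNNReal _ (by positivity)]
      field_simp
  have h2 : iIndepFun (fun i ω => σ⁻¹ * e i ω) P :=
    hindep.comp (fun _ x => σ⁻¹ * x) fun _ => by fun_prop
  have h3 := h2.hasLaw_pi h1
  rw [← map_pi_eq_stdGaussian]
  have h4 : HasLaw (WithLp.toLp 2 : (ι → ℝ) → EuclideanSpace ℝ ι)
      ((Measure.pi fun _ => gaussianReal 0 1).map (WithLp.toLp 2))
      (Measure.pi fun _ : ι => gaussianReal 0 1) := ⟨by fun_prop, rfl⟩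
  exact h4.comp h3

end ProbabilityTheory

/-! ### Difference of nested projections of consecutive ranks. -/

open scoped RealInnerProductSpace

/-- The difference projects onto `K ⊓ K'ᗮ`, which is a line by the rank condition. -/
lemma Submodule.exists_norm_eq_one_starProjection_sub {E : Type*} [NormedAddCommGroup E]
    [InnerProductSpace ℝ E] [FiniteDimensional ℝ E] {K' K : Submodule ℝ E} (hle : K' ≤ K)
    (hr : Module.finrank ℝ K' + 1 = Module.finrank ℝ K) :
    ∃ v : E, ‖v‖ = 1 ∧ ∀ y, K.starProjection y - K'.starProjection y = ⟪v, y⟫ • v := by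
  have h1 : Module.finrank ℝ ↥(K'ᗮ ⊓ K) = 1 := by
    have := Submodule.finrank_add_inf_finrank_orthogonal hle
    omega
  obtain ⟨u, hu, hspan⟩ := finrank_eq_one_iff'.1 h1
  have hu0 : ‖(u : E)‖ ≠ 0 := by simpa using hu
  obtain ⟨huK', huK⟩ := Submodule.mem_inf.1 u.2
  refine ⟨‖(u : E)‖⁻¹ • (u : E), by rw [norm_smul, norm_inv, norm_norm, inv_mul_cancel₀ hu0],
    fun y => ?_⟩
  have hort : ∀ w ∈ Kᗮ, w ∈ K'ᗮ := fun w hw => Submodule.orthogonal_le hle hw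
  have hmem : K.starProjection y - K'.starProjection y ∈ K'ᗮ ⊓ K := by
    refine Submodule.mem_inf.2 ⟨?_, K.sub_mem (K.starProjection_apply_mem y)
      (hle (K'.starProjection_apply_mem y))⟩
    have := K'ᗮ.sub_mem (K'.sub_starProjection_mem_orthogonal y)
      (hort _ (K.sub_starProjection_mem_orthogonal y))
    simpa using this
  obtain ⟨c, hc⟩ := hspan ⟨_, hmem⟩
  have hc' : K.starProjection y - K'.starProjection y = c • (u : E) := (congrArg Subtype.val hc).symm
  have hy : y = c • (u : E) + K'.starProjection y + (y - K.starProjection y) := by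
    rw [← hc']; abel
  have h2 : ⟪(u : E), K'.starProjection y⟫ = 0 :=
    Submodule.inner_left_of_mem_orthogonal (K'.starProjection_apply_mem y) huK'
  have h3 : ⟪(u : E), y - K.starProjection y⟫ = 0 :=
    Submodule.inner_right_of_mem_orthogonal huK (K.sub_starProjection_mem_orthogonal y)
  have h4 : ⟪(u : E), y⟫ = c * ‖(u : E)‖ ^ 2 := by
    conv_lhs => rw [hy]
    rw [inner_add_right, inner_add_right, h2, h3, inner_smul_right, real_inner_self_eq_norm_sq]
    ring
  rw [hc', real_inner_smul_left, h4, smul_smul]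
  congr 1
  field_simp

/-! ### Algebra of the criterion and the deterministic bound on the index. -/

namespace ParametricnessIndex

namespace Setup

variable {n : ℕ} (R : Setup n)

lemma colSpace_mono {k' k : R.Index} (h : (R.model k').family ⊆ (R.model k).family) :
    R.colSpace k' ≤ R.colSpace k := by
  refine Submodule.span_le.2 ?_
  rintro _ ⟨i, rfl⟩
  have hi : (R.model k').term i ∈ (R.model k').family := by
    refine ⟨Pi.single i 1, ?_⟩
    funext x
    simp [LinearModel.eval, Pi.single_apply]
  obtain ⟨θ, hθ⟩ := h hi
  have : (WithLp.toLp 2 fun l => (R.model k').term i (R.x l) : EuclideanSpace ℝ (Fin n))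
      = ∑ j, θ j • (WithLp.toLp 2 fun l => (R.model k).term j (R.x l)) := by
    ext l
    rw [← hθ]
    simp [LinearModel.eval]
  rw [SetLike.mem_coe]
  beta_reduce
  rw [this]
  exact Submodule.sum_mem _ fun j _ => Submodule.smul_mem _ _ (Submodule.subset_span ⟨j, rfl⟩)

lemma finrank_colSpace_orthogonal (k : R.Index) :
    (Module.finrank ℝ (R.colSpace k)ᗮ : ℝ) = n - R.rank k := by
  have := Submodule.finrank_add_finrank_orthogonal (R.colSpace k)
  rw [finrank_euclideanSpace_fin] at this
  have h : (R.rank k : ℝ) + Module.finrank ℝ (R.colSpace k)ᗮ = n := by exact_mod_cast this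
  linarith

lemma response_eq {σ : ℝ} (hσ : σ ≠ 0) (e : Fin n → ℝ) :
    R.response e = R.fvec + σ • (WithLp.toLp 2 fun i => σ⁻¹ * e i) := by
  ext i
  simp [response, fvec, hσ]

/-- Separates the mean `σ² Q` from the noise. The sign inside the inner product makes the harmful
deviation an upper tail. -/
lemma IC_eq {σ : ℝ} (hσ : σ ≠ 0) (lam d : ℝ) (e : Fin n → ℝ) (k : R.Index)
    {z : EuclideanSpace ℝ (Fin n)} (hz : z = WithLp.toLp 2 fun i => σ⁻¹ * e i) :
    R.IC lam d σ e k = σ ^ 2 * (R.Q lam d σ k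
      + (‖(R.colSpace k)ᗮ.starProjection z‖ ^ 2 - (n - R.rank k))
      - 2 * σ⁻¹ * ⟪-(R.colSpace k)ᗮ.starProjection R.fvec, z⟫) := by
  have h1 : ‖R.response e - R.proj k (R.response e)‖ ^ 2
      = ‖R.fvec - R.proj k R.fvec‖ ^ 2
        + 2 * σ * ⟪(R.colSpace k)ᗮ.starProjection R.fvec, z⟫
        + σ ^ 2 * ‖(R.colSpace k)ᗮ.starProjection z‖ ^ 2 := by
    have hin : ⟪(R.colSpace k)ᗮ.starProjection R.fvec, (R.colSpace k)ᗮ.starProjection z⟫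
        = ⟪(R.colSpace k)ᗮ.starProjection R.fvec, z⟫ := by
      rw [← Submodule.inner_starProjection_left_eq_right]
      congr 1
      exact Submodule.starProjection_eq_self_iff.2 (Submodule.starProjection_apply_mem _ _)
    rw [proj, ← Submodule.starProjection_orthogonal_val, ← Submodule.starProjection_orthogonal_val,
      R.response_eq hσ, ← hz, map_add, map_smul, norm_add_sq_real, inner_smul_right, hin, norm_smul,
      mul_pow, Real.norm_eq_abs, sq_abs]
    ring
  rw [IC, h1, Q, inner_neg_left]
  field_simp
  ring

/-- Pythagoras: the residual of `k` is orthogonal to the column space of `k`, which contains that of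
`k'`. -/
lemma IC_sub_IC_eq {σ : ℝ} (lam d : ℝ) (e : Fin n → ℝ) {k k' : R.Index} (hk' : k' ∈ R.S₁ k) :
    R.IC lam d σ e k' - R.IC lam d σ e k
      = ‖R.proj k (R.response e) - R.proj k' (R.response e)‖ ^ 2 - lam * Real.log n * σ ^ 2 := by
  set Y := R.response e
  have hle := R.colSpace_mono hk'.1
  have hort : ⟪Y - R.proj k Y, R.proj k Y - R.proj k' Y⟫ = 0 :=
    Submodule.starProjection_inner_eq_zero _ _ (Submodule.sub_mem _
      (Submodule.starProjection_apply_mem _ _) (hle (Submodule.starProjection_apply_mem _ _)))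
  have h1 : ‖Y - R.proj k' Y‖ ^ 2
      = ‖Y - R.proj k Y‖ ^ 2 + ‖R.proj k Y - R.proj k' Y‖ ^ 2 := by
    rw [← sub_add_sub_cancel Y (R.proj k Y) (R.proj k' Y), norm_add_sq_real, hort]
    ring
  have h2 : (R.rank k : ℝ) = R.rank k' + 1 := by rw [← hk'.2]; push_cast; ring
  simp only [IC]
  rw [show R.response e = Y from rfl, h1, h2]
  ring

lemma abs_PI_sub_one_le {σ : ℝ} (hσ : 0 < σ) {lam d δ : ℝ} (e : Fin n → ℝ) {k : R.Index}
    {z : EuclideanSpace ℝ (Fin n)} (hz : z = WithLp.toLp 2 fun i => σ⁻¹ * e i)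
    (hrank : 1 < R.rank k) (hQ : 0 < R.Q lam d σ k)
    (hlam0 : 0 ≤ lam * Real.log n) (hlam : lam * Real.log n ≤ δ * R.Q lam d σ k)
    (hchi : ¬ ‖(R.colSpace k)ᗮ.starProjection z‖ ^ 2
      ≤ ((n : ℝ) - R.rank k) - 9 / 10 * R.Q lam d σ k)
    (hlin : ¬ σ * R.Q lam d σ k / 40 ≤ ⟪-(R.colSpace k)ᗮ.starProjection R.fvec, z⟫)
    (hdiff : ∀ k' ∈ R.S₁ k, ¬ δ * R.Q lam d σ k ≤ ‖R.proj k z - R.proj k' z‖ ^ 2)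
    (hf : ∃ k' ∈ R.S₁ k,
      ‖R.proj k R.fvec - R.proj k' R.fvec‖ ^ 2 ≤ δ * σ ^ 2 * R.Q lam d σ k) :
    |R.PI lam d σ e k - 1| ≤ 80 * δ := by
  set q := R.Q lam d σ k
  obtain ⟨k₀, hk₀, hfk₀⟩ := hf
  push Not at hchi hlin hdiff
  have hσ2 : 0 < σ ^ 2 := by positivity
  have hδ : 0 ≤ δ := by
    by_contra! h
    nlinarith
  have hIC : σ ^ 2 * (q / 20) ≤ R.IC lam d σ e k := by
    rw [R.IC_eq hσ.ne' lam d e k hz]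
    refine mul_le_mul_of_nonneg_left ?_ hσ2.le
    have : 2 * σ⁻¹ * ⟪-(R.colSpace k)ᗮ.starProjection R.fvec, z⟫ ≤ q / 20 := by
      calc _ ≤ 2 * σ⁻¹ * (σ * q / 40) := by gcongr
        _ = q / 20 := by field_simp; norm_num
    linarith
  have hICpos : 0 < R.IC lam d σ e k := lt_of_lt_of_le (by positivity) hIC
  -- The constant 80 is `4 * 20`: the squared norm for `k₀` is at most `2 (δ + δ) σ² q`, and `σ² q ≤
  -- 20 IC`.
  have hsmall : δ * σ ^ 2 * q ≤ 20 * δ * R.IC lam d σ e k := by nlinarith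
  have hlow : ∀ k' ∈ R.S₁ k, 1 - 80 * δ ≤ R.IC lam d σ e k' / R.IC lam d σ e k := by
    intro k' hk'
    rw [le_div_iff₀ hICpos]
    have h1 := R.IC_sub_IC_eq (σ := σ) lam d e hk'
    have h2 := sq_nonneg ‖R.proj k (R.response e) - R.proj k' (R.response e)‖
    have h3 := mul_le_mul_of_nonneg_right hlam hσ2.le
    nlinarith [mul_nonneg hδ hICpos.le]
  have hup : R.IC lam d σ e k₀ / R.IC lam d σ e k ≤ 1 + 80 * δ := by
    rw [div_le_iff₀ hICpos]
    have h1 := R.IC_sub_IC_eq (σ := σ) lam d e hk₀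
    have h2 : R.proj k (R.response e) - R.proj k₀ (R.response e)
        = (R.proj k R.fvec - R.proj k₀ R.fvec) + σ • (R.proj k z - R.proj k₀ z) := by
      rw [R.response_eq hσ.ne', ← hz, map_add, map_add, map_smul, map_smul, smul_sub]
      abel
    have h3 : ‖R.proj k (R.response e) - R.proj k₀ (R.response e)‖ ^ 2
        ≤ 2 * (‖R.proj k R.fvec - R.proj k₀ R.fvec‖ ^ 2
          + σ ^ 2 * ‖R.proj k z - R.proj k₀ z‖ ^ 2) := by
      have h5 := norm_add_le (R.proj k R.fvec - R.proj k₀ R.fvec) (σ • (R.proj k z - R.proj k₀ z))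
      rw [← h2, norm_smul, Real.norm_eq_abs, abs_of_pos hσ] at h5
      refine (pow_le_pow_left₀ (norm_nonneg _) h5 2).trans ?_
      rw [← mul_pow]
      exact add_sq_le
    have h4 := mul_le_mul_of_nonneg_left (hdiff k₀ hk₀).le hσ2.le
    nlinarith [mul_nonneg hlam0 hσ2.le]
  have hPI : R.PI lam d σ e k
      = sInf ((fun k' => R.IC lam d σ e k' / R.IC lam d σ e k) '' R.S₁ k) := if_pos hrank
  rw [hPI, abs_le]
  constructor
  · rw [neg_le_sub_iff_le_add]
    have := le_csInf (Set.Nonempty.image (fun k' => R.IC lam d σ e k' / R.IC lam d σ e k)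
      ⟨k₀, hk₀⟩) (Set.forall_mem_image.2 hlow)
    linarith
  · have := csInf_le ⟨1 - 80 * δ, Set.forall_mem_image.2 hlow⟩
      (Set.mem_image_of_mem (fun k' => R.IC lam d σ e k' / R.IC lam d σ e k) hk₀)
    linarith [this.trans hup]

end Setup

end ParametricnessIndex

/-! ### Union bound over the models of one rank. -/

lemma MeasureTheory.measure_biUnion_le_encard_mul {α ι : Type*} [MeasurableSpace α]
    (μ : Measure α) {A : Set ι} {s : ι → Set α} {p : ℝ≥0∞} (hA : A.Finite ∨ p ≠ 0)
    (h : ∀ i ∈ A, μ (s i) ≤ p) : μ (⋃ i ∈ A, s i) ≤ (A.encard : ℝ≥0∞) * p := by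
  by_cases hfin : A.Finite
  · have h1 := measure_biUnion_finset_le (μ := μ) hfin.toFinset s
    simp only [Set.Finite.mem_toFinset] at h1
    refine h1.trans ((Finset.sum_le_card_nsmul _ _ p fun i hi => h i (by simpa using hi)).trans ?_)
    rw [hfin.encard_eq_coe_toFinset_card, nsmul_eq_mul]
    simp
  -- Since `⊤ * 0 = 0`, an infinite index set needs `p ≠ 0`.
  · rw [Set.encard_eq_top_iff.2 hfin, ENat.toENNReal_top,
      ENNReal.top_mul (hA.resolve_left hfin)]
    exact le_top

namespace ParametricnessIndex

namespace Setup

variable {n : ℕ} (R : Setup n)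

lemma rank_mul_le_Q {σ lam d : ℝ} (hd : 0 ≤ d) (k : R.Index) :
    (lam * Real.log n - 1) * R.rank k ≤ R.Q lam d σ k := by
  have h1 : 0 ≤ d * Real.sqrt n * Real.log n :=
    mul_nonneg (mul_nonneg hd (Real.sqrt_nonneg _)) (Real.log_natCast_nonneg n)
  have h2 : 0 ≤ ‖R.fvec - R.proj k R.fvec‖ ^ 2 / σ ^ 2 := by positivity
  simp only [Q]
  linarith

lemma Q_nonneg {σ lam d : ℝ} (hlam : 1 ≤ lam * Real.log n) (hd : 0 ≤ d) (k : R.Index) :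
    0 ≤ R.Q lam d σ k :=
  (mul_nonneg (by linarith) (Nat.cast_nonneg _)).trans (R.rank_mul_le_Q hd k)

lemma norm_sq_le_mul_Q {σ lam d : ℝ} (hσ : 0 < σ) (hlam : 1 ≤ lam * Real.log n) (hd : 0 ≤ d)
    (k : R.Index) : ‖(R.colSpace k)ᗮ.starProjection R.fvec‖ ^ 2 ≤ σ ^ 2 * R.Q lam d σ k := by
  have h1 : 0 ≤ d * Real.sqrt n * Real.log n :=
    mul_nonneg (mul_nonneg hd (Real.sqrt_nonneg _)) (Real.log_natCast_nonneg n)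
  have h2 : 0 ≤ (lam * Real.log n - 1) * R.rank k :=
    mul_nonneg (by linarith) (Nat.cast_nonneg _)
  rw [mul_comm, ← div_le_iff₀ (by positivity), Submodule.starProjection_orthogonal_val, Q, proj]
  linarith

lemma B_nonneg {σ lam d : ℝ} (hlam : 1 ≤ lam * Real.log n) (hd : 0 ≤ d) (j : ℕ) :
    0 ≤ R.B lam d σ j :=
  Real.sInf_nonneg (Set.forall_mem_image.2 fun k _ => R.Q_nonneg hlam hd k)

lemma B_le_Q {σ lam d : ℝ} (hlam : 1 ≤ lam * Real.log n) (hd : 0 ≤ d) (k : R.Index) :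
    R.B lam d σ (R.rank k) ≤ R.Q lam d σ k :=
  csInf_le ⟨0, Set.forall_mem_image.2 fun k _ => R.Q_nonneg hlam hd k⟩
    (Set.mem_image_of_mem _ (by simp))

/-- The noise vectors for which the criterion of model `k` is far below its mean, or some sub-model
in `S₁ k` fits the noise noticeably worse. -/
def deviationSet (lam d σ δ : ℝ) (k : R.Index) : Set (EuclideanSpace ℝ (Fin n)) :=
  {z | ‖(R.colSpace k)ᗮ.starProjection z‖ ^ 2 ≤ ((n : ℝ) - R.rank k) - 9 / 10 * R.Q lam d σ k} ∪
  {z | σ * R.Q lam d σ k / 40 ≤ ⟪-(R.colSpace k)ᗮ.starProjection R.fvec, z⟫} ∪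
  ⋃ k' ∈ R.S₁ k, {z | δ * R.Q lam d σ k ≤ ‖R.proj k z - R.proj k' z‖ ^ 2}

lemma stdGaussian_norm_sq_proj_sub_le {k k' : R.Index} (hk' : k' ∈ R.S₁ k) {c : ℝ} (hc : 0 ≤ c) :
    stdGaussian (EuclideanSpace ℝ (Fin n)) {z | c ≤ ‖R.proj k z - R.proj k' z‖ ^ 2}
      ≤ ENNReal.ofReal (2 * Real.exp (-(c / 2))) := by
  obtain ⟨v, hv, hproj⟩ := Submodule.exists_norm_eq_one_starProjection_sub
    (R.colSpace_mono hk'.1) hk'.2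
  simp only [proj, hproj, norm_smul, hv, mul_one, Real.norm_eq_abs, sq_abs]
  exact stdGaussian_inner_sq_ge_le hv hc

lemma stdGaussian_biUnion_deviationSet_le {σ lam d δ ζ c₀ : ℝ} {j : ℕ} (hj : j < n) (hσ : 0 < σ)
    (hlam : 1 ≤ lam * Real.log n) (hd : 0 ≤ d) (hδ : 0 < δ) (hc₀ : 0 < c₀) (hζ : ζ ≤ δ / 4)
    (hB : R.B lam d σ j / ((n : ℝ) - j) ≤ min (1 / 640) (5 * δ / 2))
    (hN : ((R.N j : ℕ∞) : ℝ≥0∞)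
      ≤ ENNReal.ofReal (c₀ * Real.exp (R.B lam d σ j ^ 2 / (10 * ((n : ℝ) - j)))))
    (hNL : ((R.N j * R.L j : ℕ∞) : ℝ≥0∞) ≤ ENNReal.ofReal (c₀ * Real.exp (ζ * R.B lam d σ j))) :
    stdGaussian (EuclideanSpace ℝ (Fin n))
        (⋃ k ∈ {k | R.rank k = j}, R.deviationSet lam d σ δ k)
      ≤ ENNReal.ofReal
        (4 * c₀ * Real.exp (-(R.B lam d σ j ^ 2 / (10 * ((n : ℝ) - j))))) := by
  set γ := stdGaussian (EuclideanSpace ℝ (Fin n))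
  set A := {k : R.Index | R.rank k = j}
  set β := R.B lam d σ j
  set m : ℝ := (n : ℝ) - j with hm_def
  have hm : 0 < m := by
    have : (j : ℝ) < n := by exact_mod_cast hj
    linarith
  have hβ : 0 ≤ β := R.B_nonneg hlam hd j
  have hβQ : ∀ k ∈ A, β ≤ R.Q lam d σ k := by
    intro k hk
    have := R.B_le_Q (σ := σ) hlam hd k
    rwa [show R.rank k = j from hk] at this
  have hA : A.Finite := by
    rw [← Set.encard_lt_top_iff, ← ENat.toENNReal_lt, ENat.toENNReal_top]
    exact hN.trans_lt ENNReal.ofReal_lt_top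
  -- `w` is the exponent of the target bound
  set w := β ^ 2 / (10 * m) with hw
  -- As `w = β (β / m) / 10`, the bound 1/640 matches the rate 1/3200 of the linear term. The bound
  -- `5δ/2` gives `δβ/4`, what is left of the rate `δβ/2` after a count `exp (ζβ)` with `ζ ≤ δ/4`.
  have hw1 : 2 * w ≤ β / 3200 := by
    have h := mul_le_mul_of_nonneg_left (hB.trans (min_le_left _ _)) hβ
    have : 2 * w = β * (β / m) / 5 := by rw [hw]; field_simp; ring
    linarith
  have hw2 : w ≤ δ * β / 4 := by
    have h := mul_le_mul_of_nonneg_left (hB.trans (min_le_right _ _)) hβ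
    have : w = β * (β / m) / 10 := by rw [hw]; field_simp
    linarith
  have hunion : ∀ (C p : ℝ) (s : R.Index → Set (EuclideanSpace ℝ (Fin n))), 0 ≤ C →
      2 * w ≤ p → (∀ k ∈ A, γ (s k) ≤ ENNReal.ofReal (C * Real.exp (-p))) →
      γ (⋃ k ∈ A, s k) ≤ ENNReal.ofReal (C * c₀ * Real.exp (-w)) := by
    intro C p s hC hp hs
    refine (measure_biUnion_le_encard_mul γ (.inl hA) hs).trans ?_
    refine (mul_le_mul_left hN _).trans ?_
    rw [← ENNReal.ofReal_mul (by positivity)]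
    refine ENNReal.ofReal_le_ofReal ?_
    calc c₀ * Real.exp w * (C * Real.exp (-p)) = C * c₀ * Real.exp (w + -p) := by
          rw [Real.exp_add]; ring
      _ ≤ C * c₀ * Real.exp (-w) := by
          gcongr; linarith
  have hchi : γ (⋃ k ∈ A, {z | ‖(R.colSpace k)ᗮ.starProjection z‖ ^ 2
        ≤ ((n : ℝ) - R.rank k) - 9 / 10 * R.Q lam d σ k})
      ≤ ENNReal.ofReal (1 * c₀ * Real.exp (-w)) := by
    refine hunion 1 (2 * w) _ zero_le_one le_rfl fun k hk => ?_
    have hkj : R.rank k = j := hk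
    have hQ := hβQ k hk
    rw [hkj, one_mul]
    refine (stdGaussian_norm_sq_starProjection_le (R.colSpace k)ᗮ hm
      (by rw [R.finrank_colSpace_orthogonal, hkj]) (by linarith)).trans ?_
    refine ENNReal.ofReal_le_ofReal (Real.exp_le_exp.2 (neg_le_neg ?_))
    -- `(9/10)² > 4/5`, so the tail exponent is at least `2w`; one `w` pays for the count `N_j`.
    have h1 : 2 * w = (4 / 5 * β ^ 2) / (4 * m) := by rw [hw]; field_simp; ring
    rw [h1]
    gcongr
    nlinarith
  have hlin : γ (⋃ k ∈ A, {z | σ * R.Q lam d σ k / 40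
        ≤ ⟪-(R.colSpace k)ᗮ.starProjection R.fvec, z⟫})
      ≤ ENNReal.ofReal (1 * c₀ * Real.exp (-w)) := by
    refine hunion 1 (β / 3200) _ zero_le_one hw1 fun k hk => ?_
    have hQ := hβQ k hk
    rw [one_mul]
    -- The optimal `s` for variance `σ² Q`, which bounds the true variance.
    refine (stdGaussian_inner_ge_le _ (s := (40 * σ)⁻¹) (by positivity) _).trans ?_
    refine ENNReal.ofReal_le_ofReal (Real.exp_le_exp.2 ?_)
    rw [norm_neg]
    have h1 := mul_le_mul_of_nonneg_left (R.norm_sq_le_mul_Q hσ hlam hd k)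
      (show 0 ≤ (40 * σ)⁻¹ ^ 2 / 2 by positivity)
    have h2 : (40 * σ)⁻¹ ^ 2 / 2 * (σ ^ 2 * R.Q lam d σ k) = R.Q lam d σ k / 3200 := by
      field_simp; ring
    have h3 : (40 * σ)⁻¹ * (σ * R.Q lam d σ k / 40) = R.Q lam d σ k / 1600 := by
      field_simp; ring
    rw [h3]
    linarith
  have hdiff : γ (⋃ k ∈ A, ⋃ k' ∈ R.S₁ k,
        {z | δ * R.Q lam d σ k ≤ ‖R.proj k z - R.proj k' z‖ ^ 2})
      ≤ ENNReal.ofReal (2 * c₀ * Real.exp (-w)) := by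
    have h1 : ∀ k ∈ A, γ (⋃ k' ∈ R.S₁ k,
        {z | δ * R.Q lam d σ k ≤ ‖R.proj k z - R.proj k' z‖ ^ 2})
        ≤ (R.L j : ℝ≥0∞) * ENNReal.ofReal (2 * Real.exp (-(δ * β / 2))) := by
      intro k hk
      have hQ := hβQ k hk
      refine (measure_biUnion_le_encard_mul γ (p := ENNReal.ofReal (2 * Real.exp (-(δ * β / 2))))
        (.inr ?_) fun k' hk' => ?_).trans ?_
      · exact (ENNReal.ofReal_pos.2 (by positivity)).ne'
      · refine (R.stdGaussian_norm_sq_proj_sub_le hk'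
          (mul_nonneg hδ.le (hβ.trans hQ))).trans ?_
        refine ENNReal.ofReal_le_ofReal ?_
        gcongr
      · gcongr
        rw [Setup.L]
        exact le_iSup₂ (f := fun k (_ : k ∈ {k | R.rank k = j}) => (R.S₁ k).encard) k hk
    refine (measure_biUnion_le_encard_mul γ (.inl hA) h1).trans ?_
    rw [← mul_assoc]
    change ((R.N j : ℕ∞) : ℝ≥0∞) * _ * _ ≤ _
    rw [← ENat.toENNReal_mul]
    refine (mul_le_mul_left hNL _).trans ?_
    rw [← ENNReal.ofReal_mul (by positivity)]
    refine ENNReal.ofReal_le_ofReal ?_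
    calc c₀ * Real.exp (ζ * β) * (2 * Real.exp (-(δ * β / 2)))
        = 2 * c₀ * Real.exp (ζ * β + -(δ * β / 2)) := by rw [Real.exp_add]; ring
      _ ≤ 2 * c₀ * Real.exp (-w) := by
          have := mul_le_mul_of_nonneg_right hζ hβ
          gcongr
          linarith
  simp only [deviationSet, Set.iUnion_union_distrib]
  refine (measure_union_le _ _).trans ((add_le_add ((measure_union_le _ _).trans
    (add_le_add hchi hlin)) hdiff).trans_eq ?_)
  rw [← ENNReal.ofReal_add (by positivity) (by positivity),
    ← ENNReal.ofReal_add (by positivity) (by positivity)]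
  congr 1
  ring

lemma mem_ranks {a b : ℕ} {k : R.Index} (ha : a ≤ R.rank k) (hb : R.rank k ≤ b) :
    R.rank k ∈ R.ranks a b := by
  simp [ranks, ha, hb]

lemma le_of_mem_ranks {a b j : ℕ} (hj : j ∈ R.ranks a b) : j ≤ b := by
  simp only [ranks, Finset.mem_filter, Finset.mem_Icc] at hj
  exact hj.1.2

lemma lam_mul_log_le {σ lam d δ : ℝ} (hlam : 1 ≤ lam * Real.log n) (hd : 0 ≤ d) (hδ : 0 < δ)
    {k : R.Index} (hrank : 2 / δ ≤ R.rank k) (hQ : 2 / δ ≤ R.Q lam d σ k) :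
    lam * Real.log n ≤ δ * R.Q lam d σ k := by
  rw [div_le_iff₀ hδ] at hrank hQ
  -- A bounded penalty is absorbed by large `Q`; otherwise `λ log n ≤ 2 (λ log n - 1)`, and large
  -- rank absorbs it.
  rcases le_or_gt (lam * Real.log n) 2 with h | h
  · linarith
  · have h1 := mul_le_mul_of_nonneg_left (R.rank_mul_le_Q (σ := σ) (lam := lam) hd k) hδ.le
    nlinarith

end Setup

end ParametricnessIndex

/-! ### Eventual consequences of the asymptotic conditions. -/

namespace ParametricnessIndex

section Conditions

variable {R : (n : ℕ) → Setup n} {lam : ℕ → ℝ} {d σ : ℝ} {a b : ℕ → ℕ}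

lemma eventually_B_div_le {η : ℝ} (hη : 0 < η)
    (h : Tendsto (fun n => ⨆ j ∈ (R n).ranks (a n) (b n),
      ENNReal.ofReal ((R n).B (lam n) d σ j / ((n : ℝ) - j))) atTop (𝓝 0)) :
    ∀ᶠ n in atTop, ∀ j ∈ (R n).ranks (a n) (b n), (R n).B (lam n) d σ j / ((n : ℝ) - j) ≤ η := by
  filter_upwards [h.eventually (eventually_le_nhds (ENNReal.ofReal_pos.2 hη))] with n hn j hj
  exact (ENNReal.ofReal_le_ofReal_iff hη.le).1
    ((le_iSup₂ (f := fun j (_ : j ∈ (R n).ranks (a n) (b n)) =>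
      ENNReal.ofReal ((R n).B (lam n) d σ j / ((n : ℝ) - j))) j hj).trans hn)

/-- A small sum forces each `B² / (10 (n - j))` to be large, and this is at most `B / 10` once `B ≤
n - j`. -/
lemma eventually_le_B (hlam : ∀ᶠ n : ℕ in atTop, 1 ≤ lam n * Real.log n) (hd : 0 ≤ d)
    (hb : ∀ᶠ n in atTop, b n < n)
    (h1 : Tendsto (fun n => ⨆ j ∈ (R n).ranks (a n) (b n),
      ENNReal.ofReal ((R n).B (lam n) d σ j / ((n : ℝ) - j))) atTop (𝓝 0))
    (h2 : Tendsto (fun n => ∑ j ∈ (R n).ranks (a n) (b n),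
      Real.exp (-((R n).B (lam n) d σ j ^ 2 / (10 * ((n : ℝ) - j))))) atTop (𝓝 0)) (K : ℝ) :
    ∀ᶠ n in atTop, ∀ j ∈ (R n).ranks (a n) (b n), K ≤ (R n).B (lam n) d σ j := by
  filter_upwards [hlam, hb, eventually_B_div_le one_pos h1,
    h2.eventually (eventually_lt_nhds (Real.exp_pos (-(K / 10))))] with n hlam hb hB hsum j hj
  have hm : (0 : ℝ) < n - j := by
    have : (j : ℝ) < n := by exact_mod_cast ((R n).le_of_mem_ranks hj).trans_lt hb
    linarith
  have hterm := (Finset.single_le_sum (f := fun j =>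
    Real.exp (-((R n).B (lam n) d σ j ^ 2 / (10 * ((n : ℝ) - j)))))
    (fun _ _ => (Real.exp_pos _).le) hj).trans_lt hsum
  rw [Real.exp_lt_exp, neg_lt_neg_iff] at hterm
  have h0 := mul_le_mul_of_nonneg_left (hB j hj) ((R n).B_nonneg (σ := σ) hlam hd j)
  have h3 : (R n).B (lam n) d σ j ^ 2 / (10 * ((n : ℝ) - j))
      = (R n).B (lam n) d σ j * ((R n).B (lam n) d σ j / ((n : ℝ) - j)) / 10 := by
    field_simp
  rw [h3] at hterm
  linarith

lemma N3.eventually_exists (h : N3 R lam d σ a b) {c : ℝ} (hc : 0 < c) :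
    ∀ᶠ n in atTop, ∀ k : (R n).Index, a n ≤ (R n).rank k → (R n).rank k ≤ b n →
      0 < (R n).Q (lam n) d σ k → ∃ k' ∈ (R n).S₁ k,
        ‖(R n).proj k (R n).fvec - (R n).proj k' (R n).fvec‖ ^ 2
          ≤ c * (R n).Q (lam n) d σ k := by
  have h0 : limsup (fun n => ⨆ k ∈ {k : (R n).Index | a n ≤ (R n).rank k ∧ (R n).rank k ≤ b n},
      (⨅ k' ∈ (R n).S₁ k,
        ENNReal.ofReal (‖(R n).proj k (R n).fvec - (R n).proj k' (R n).fvec‖ ^ 2)) /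
      ENNReal.ofReal ((R n).Q (lam n) d σ k)) atTop < ENNReal.ofReal c := by
    rw [N3] at h
    rw [h]
    exact ENNReal.ofReal_pos.2 hc
  filter_upwards [eventually_lt_of_limsup_lt h0] with n hn k hka hkb hQ
  have h1 := (le_iSup₂ (f := fun k
    (_ : k ∈ {k : (R n).Index | a n ≤ (R n).rank k ∧ (R n).rank k ≤ b n}) =>
      (⨅ k' ∈ (R n).S₁ k,
        ENNReal.ofReal (‖(R n).proj k (R n).fvec - (R n).proj k' (R n).fvec‖ ^ 2)) /
      ENNReal.ofReal ((R n).Q (lam n) d σ k)) k ⟨hka, hkb⟩).trans_lt hn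
  rw [ENNReal.div_lt_iff (.inl (ENNReal.ofReal_pos.2 hQ).ne') (.inl ENNReal.ofReal_ne_top),
    ← ENNReal.ofReal_mul hc.le] at h1
  obtain ⟨k', hk', hlt⟩ := by simpa only [iInf_lt_iff] using h1
  exact ⟨k', hk', (ENNReal.ofReal_le_ofReal_iff (by positivity)).1 hlt.le⟩

end Conditions

end ParametricnessIndex

/-! ### Convergence in probability. -/

theorem theorem2
    {Ω : Type*} [MeasurableSpace Ω] (P : Measure Ω) [IsProbabilityMeasure P]
    (R : (n : ℕ) → ParametricnessIndex.Setup n)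
    -- whenever a candidate model has rank larger than one, `S₁` of it is not empty
    (hS : ∀ (n : ℕ) (k : (R n).Index), 1 < (R n).rank k → ((R n).S₁ k).Nonempty)
    -- independent `N(0, σ²)` errors at each sample size
    (σ : ℝ) (hσ : 0 < σ) (ε : (n : ℕ) → Fin n → Ω → ℝ)
    (hindep : ∀ n, iIndepFun (ε n) P)
    (hlaw : ∀ (n : ℕ) (i : Fin n), HasLaw (ε n i) (gaussianReal 0 (σ ^ 2).toNNReal) P)
    -- the selected models
    (khat : (n : ℕ) → Ω → (R n).Index)
    (hkhat : ∀ (n : ℕ) (s : Set (R n).Index), MeasurableSet (khat n ⁻¹' s))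
    (lam : ℕ → ℝ) (hlam : ∀ n : ℕ, 2 ≤ n → (Real.log n)⁻¹ ≤ lam n) (d : ℝ) (hd : 0 ≤ d)
    -- nonparametric scenario
    (hnonpar : ∀ (n : ℕ) (k : (R n).Index), (R n).f ∉ ((R n).model k).family)
    (a b : ℕ → ℕ) (hab : ∀ᶠ n in atTop, 1 ≤ a n ∧ a n < b n ∧ b n < n)
    (ha : Tendsto a atTop atTop)
    (h1 : ParametricnessIndex.N1 R lam d σ a b P khat)
    (h2 : ParametricnessIndex.N2 R lam d σ a b)
    (h3 : ParametricnessIndex.N3 R lam d σ a b) :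
    TendstoInMeasure P
      (fun n ω => (R n).PI (lam n) d σ (fun i => ε n i ω) (khat n ω)) atTop (fun _ => 1) := by
  obtain ⟨hin, hBdiv⟩ := h1
  obtain ⟨⟨ζ, c₀, -, hζ, hc₀, hcount⟩, hsum⟩ := h2
  have hlam1 : ∀ᶠ n : ℕ in atTop, 1 ≤ lam n * Real.log n := by
    filter_upwards [eventually_ge_atTop 2] with n hn
    have hlog : 0 < Real.log n := Real.log_pos (by exact_mod_cast hn)
    exact (inv_le_iff_one_le_mul₀ hlog).1 (hlam n hn)
  rw [tendstoInMeasure_iff_norm]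
  intro η hη
  set δ : ℝ := η / 160 with hδ_def
  have hδ : 0 < δ := by positivity
  set good : (n : ℕ) → Set Ω := fun n =>
    {ω | a n ≤ (R n).rank (khat n ω) ∧ (R n).rank (khat n ω) ≤ b n} with hgood
  set bound : ℕ → ℝ≥0∞ := fun n => (1 - P (good n)) + ENNReal.ofReal (4 * c₀ *
    ∑ j ∈ (R n).ranks (a n) (b n),
      Real.exp (-((R n).B (lam n) d σ j ^ 2 / (10 * ((n : ℝ) - j))))) with hbound
  have hlim : Tendsto bound atTop (𝓝 0) := by
    have e1 : Tendsto (fun n => 1 - P (good n)) atTop (𝓝 (1 - 1)) :=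
      ENNReal.Tendsto.sub tendsto_const_nhds hin (.inl ENNReal.one_ne_top)
    have e2 := ENNReal.tendsto_ofReal (hsum.const_mul (4 * c₀))
    simpa using e1.add e2
  refine tendsto_of_tendsto_of_tendsto_of_le_of_le' tendsto_const_nhds hlim
    (Eventually.of_forall fun _ => zero_le) ?_
  have hK : 0 < 2 / δ := by positivity
  -- Rank at least 2 excludes the default value `n` of the index; rank at least `2/δ` makes the
  -- penalty negligible.
  filter_upwards [hlam1, hab, ha.eventually_ge_atTop (max 2 ⌈2 / δ⌉₊),
    ParametricnessIndex.eventually_B_div_le (η := min (1 / 640) (5 * δ / 2)) (by positivity) hBdiv,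
    ParametricnessIndex.eventually_le_B hlam1 hd (hab.mono fun _ h => h.2.2) hBdiv hsum (2 / δ),
    h3.eventually_exists (c := δ * σ ^ 2) (by positivity),
    hζ.eventually (eventually_le_nhds (show (0 : ℝ) < δ / 4 by positivity)), hcount]
    with n hlamn habn han hBn hKn hfn hζn hcn
  set Z : Ω → EuclideanSpace ℝ (Fin n) := fun ω => WithLp.toLp 2 fun i => σ⁻¹ * ε n i ω with hZ
  have hZlaw := hasLaw_stdGaussian_of_iIndepFun hσ (hindep n) (hlaw n)
  set dev : ℕ → Set (EuclideanSpace ℝ (Fin n)) := fun j =>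
    ⋃ k ∈ {k | (R n).rank k = j}, (R n).deviationSet (lam n) d σ δ k with hdev
  have hsub : {ω | η ≤ ‖(R n).PI (lam n) d σ (fun i => ε n i ω) (khat n ω) - 1‖}
      ⊆ (good n)ᶜ ∪ ⋃ j ∈ (R n).ranks (a n) (b n), Z ⁻¹' dev j := by
    intro ω hω
    by_contra hcon
    simp only [Set.mem_union, not_or, Set.mem_compl_iff, not_not] at hcon
    obtain ⟨⟨hra, hrb⟩, hnot⟩ := hcon
    set k := khat n ω
    have hdevk : Z ω ∉ (R n).deviationSet (lam n) d σ δ k := by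
      intro hmem
      refine hnot (Set.mem_biUnion (x := (R n).rank k) ((R n).mem_ranks hra hrb) ?_)
      exact Set.mem_biUnion (x := k) (by simp) hmem
    simp only [ParametricnessIndex.Setup.deviationSet, Set.mem_union, Set.mem_iUnion, not_or,
      Set.mem_ofPred_eq, exists_prop, not_exists, not_and] at hdevk
    have hQ : 2 / δ ≤ (R n).Q (lam n) d σ k :=
      (hKn _ ((R n).mem_ranks hra hrb)).trans ((R n).B_le_Q hlamn hd k)
    have hrank : 2 / δ ≤ (R n).rank k :=
      (Nat.le_ceil _).trans (by exact_mod_cast ((le_max_right _ _).trans han).trans hra)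
    have hQ0 : 0 < (R n).Q (lam n) d σ k := hK.trans_le hQ
    have hPI := (R n).abs_PI_sub_one_le hσ (fun i => ε n i ω) (z := Z ω) rfl
      (((le_max_left _ _).trans han).trans hra) hQ0 (by linarith)
      ((R n).lam_mul_log_le hlamn hd hδ hrank hQ) hdevk.1.1 hdevk.1.2 hdevk.2
      (hfn k hra hrb hQ0)
    have hω' : η ≤ |(R n).PI (lam n) d σ (fun i => ε n i ω) k - 1| := hω
    linarith
  have hmeas : MeasurableSet (good n) := hkhat n {k | a n ≤ (R n).rank k ∧ (R n).rank k ≤ b n}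
  refine (measure_mono hsub).trans ((measure_union_le _ _).trans ?_)
  rw [prob_compl_eq_one_sub hmeas]
  refine add_le_add le_rfl ((measure_biUnion_finset_le _ _).trans ?_)
  rw [Finset.mul_sum, ENNReal.ofReal_sum_of_nonneg fun _ _ => by positivity]
  refine Finset.sum_le_sum fun j hj => ?_
  -- This inequality holds for every set, so `dev j` need not be measurable.
  refine (Measure.le_map_apply hZlaw.aemeasurable _).trans ?_
  rw [hZlaw.map_eq]
  exact (R n).stdGaussian_biUnion_deviationSet_le
    (((R n).le_of_mem_ranks hj).trans_lt habn.2.2) hσ hlamn hd hδ hc₀ hζn (hBn j hj)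
    (hcn j hj).2 (hcn j hj).1
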